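/- Let $m\ge 0$ be an integer and let $\rho$ be an $m$-mode quantum state, i.e. a positive semi-definite trace class operator with $\operatorname{Tr}\rho=1$ on the Hilbert space $L^2(\mathbb{R}^m)$. For $z\in\mathbb{C}^m$ let $\mathcal{D}(z)=\exp\big[\sum_{j=1}^m (z_j a_j^\dagger-z_j^* a_j)\big]$ be the displacement operator, where $a_j=(x_j+ip_j)/\sqrt2$, $a_j^\dagger=(x_j-ip_j)/\sqrt2$, $x_j$ is multiplication by the $j$-th coordinate and $p_j=-i\,\partial_j$. Explicitly, with $z=z_R+iz_I$, $z_R,z_I\in\mathbb{R}^m$, $$(\mathcal{D}(z)f)(x)=e^{i(\sqrt2\,z_I\cdot x-z_I\cdot z_R)}\,f(x-\sqrt2\,z_R),\qquad f\in L^2(\mathbb{R}^m).$$ Then $\rho\,\mathcal{D}(z)$ is trace class for every $z\in\mathbb{C}^m$, and the quantum characteristic function $\chi_\rho(z)=\operatorname{Tr}[\rho\,\mathcal{D}(z)]$ is a continuous function on $\mathbb{C}^m$ that vanishes at infinity, i.e. $\chi_\rho\in C_0(\mathbb{C}^m)$. Moreover, for every $\varepsilon>0$, $$\sup_{z\in\mathbb{C}^m,\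 |z|\ge\varepsilon}|\chi_\rho(z)|<1,$$ where $|z|$ is the Euclidean norm (for $m=0$ the supremum is over the empty set and is read as $0$). -/

import Mathlib

open MeasureTheory Filter
open scoped ContDiff InnerProductSpace ENNReal ComplexConjugate Topology ZeroAtInfty

noncomputable section

namespace QuantumCF

/-- Configuration space `ℝ^m` of `m` modes, with its Euclidean structure. -/
abbrev Config (m : ℕ) : Type := EuclideanSpace ℝ (Fin m)

/-- The Hilbert space `L²(ℝ^m)` of `m` modes. -/
abbrev ModeSpace (m : ℕ) : Type := Lp ℂ 2 (volume : Measure (Config m))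

/-- The phase space `ℂ^m`, with the Euclidean norm. -/
abbrev PhaseSpace (m : ℕ) : Type := EuclideanSpace ℂ (Fin m)

/-! ### Canonical operators, acting on functions `ℝ^m → ℂ` -/

/-- `(x_j f)(x) = x_j f(x)`. -/
def position {m : ℕ} (j : Fin m) (f : Config m → ℂ) : Config m → ℂ :=
  fun x => (x j : ℂ) * f x

/-- `p_j f = -i ∂_j f`. -/
def momentum {m : ℕ} (j : Fin m) (f : Config m → ℂ) : Config m → ℂ :=
  fun x => -Complex.I * fderiv ℝ f x (EuclideanSpace.single j 1)

/-- `a_j = (x_j + i p_j) / √2`. -/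
def annihilation {m : ℕ} (j : Fin m) (f : Config m → ℂ) : Config m → ℂ :=
  fun x => (position j f x + Complex.I * momentum j f x) / (Real.sqrt 2 : ℂ)

/-- `a_j† = (x_j - i p_j) / √2`. -/
def creation {m : ℕ} (j : Fin m) (f : Config m → ℂ) : Config m → ℂ :=
  fun x => (position j f x - Complex.I * momentum j f x) / (Real.sqrt 2 : ℂ)

/-- `∑_j (z_j a_j† - z_j^* a_j)`, the exponent of the displacement operator. -/
def displacementGenerator {m : ℕ} (z : PhaseSpace m) (f : Config m → ℂ) : Config m → ℂ :=
  fun x => ∑ j, (z j * creation j f x - conj (z j) * annihilation j f x)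

/-! ### Displacement operators -/

/-- `z_R`, the componentwise real part of `z`. -/
def rePart {m : ℕ} (z : PhaseSpace m) : Config m := WithLp.toLp 2 fun j => (z j).re

/-- `z_I`, the componentwise imaginary part of `z`. -/
def imPart {m : ℕ} (z : PhaseSpace m) : Config m := WithLp.toLp 2 fun j => (z j).im

/-- The phase `e^{i (√2 z_I·x - z_I·z_R)}`. -/
def weylPhase {m : ℕ} (z : PhaseSpace m) (x : Config m) : ℂ :=
  Complex.exp (((Real.sqrt 2 * ⟪imPart z, x⟫_ℝ - ⟪imPart z, rePart z⟫_ℝ : ℝ) : ℂ) * Complex.I)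

/-- `(D(z) f)(x) = e^{i (√2 z_I·x - z_I·z_R)} f(x - √2 z_R)`, on functions. -/
def weylFun {m : ℕ} (z : PhaseSpace m) (f : Config m → ℂ) : Config m → ℂ :=
  fun x => weylPhase z x * f (x - Real.sqrt 2 • rePart z)

theorem norm_weylPhase {m : ℕ} (z : PhaseSpace m) (x : Config m) : ‖weylPhase z x‖ = 1 := by
  unfold weylPhase
  exact Complex.norm_exp_ofReal_mul_I _

theorem continuous_weylPhase {m : ℕ} (z : PhaseSpace m) : Continuous (weylPhase z) := by
  unfold weylPhase
  fun_prop

theorem weylFun_congr {m : ℕ} (z : PhaseSpace m) {f g : Config m → ℂ} (h : f =ᵐ[volume] g) :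
    weylFun z f =ᵐ[volume] weylFun z g := by
  have := (measurePreserving_sub_right (volume : Measure (Config m))
    (Real.sqrt 2 • rePart z)).quasiMeasurePreserving.ae_eq h
  filter_upwards [this] with x hx
  simp only [Function.comp_def] at hx
  simp [weylFun, hx]

theorem eLpNorm_weylFun {m : ℕ} (z : PhaseSpace m) {f : Config m → ℂ}
    (hf : AEStronglyMeasurable f volume) :
    eLpNorm (weylFun z f) 2 volume = eLpNorm f 2 volume := by
  rw [← eLpNorm_comp_measurePreserving hf (measurePreserving_sub_right
    (volume : Measure (Config m)) (Real.sqrt 2 • rePart z))]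
  apply eLpNorm_congr_norm_ae
  exact Eventually.of_forall fun x => by simp [weylFun, norm_weylPhase]

theorem memLp_weylFun {m : ℕ} (z : PhaseSpace m) {f : Config m → ℂ} (hf : MemLp f 2 volume) :
    MemLp (weylFun z f) 2 volume := by
  refine ⟨?_, ?_⟩
  · exact (continuous_weylPhase z).aestronglyMeasurable.mul
      (hf.1.comp_measurePreserving (measurePreserving_sub_right _ _))
  · rw [eLpNorm_weylFun z hf.1]
    exact hf.2

/-- The displacement operator `D(z) = exp(∑_j (z_j a_j† - z_j^* a_j))` on `L²(ℝ^m)`, in the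
Schrödinger representation. That it is this exponential, i.e. that `t ↦ D(t z)` is the unique
one-parameter unitary group generated by `∑_j (z_j a_j† - z_j^* a_j)`, is
`isUnitaryGroupGeneratedBy_iff` below. -/
def displacement {m : ℕ} (z : PhaseSpace m) : ModeSpace m →L[ℂ] ModeSpace m :=
  LinearIsometry.toContinuousLinearMap
    { toFun := fun f => (memLp_weylFun z (Lp.memLp f)).toLp (weylFun z f)
      map_add' := fun f g => by
        rw [← MemLp.toLp_add, MemLp.toLp_eq_toLp_iff]
        refine (weylFun_congr z (Lp.coeFn_add f g)).trans (Eventually.of_forall fun x => ?_)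
        simp [weylFun, mul_add]
      map_smul' := fun c f => by
        rw [RingHom.id_apply, ← MemLp.toLp_const_smul, MemLp.toLp_eq_toLp_iff]
        refine (weylFun_congr z (Lp.coeFn_smul c f)).trans (Eventually.of_forall fun x => ?_)
        simp [weylFun, mul_left_comm]
      norm_map' := fun f => by
        change ‖(memLp_weylFun z (Lp.memLp f)).toLp (weylFun z f)‖ = ‖f‖
        rw [Lp.norm_toLp, eLpNorm_weylFun z (Lp.memLp f).1, Lp.norm_def] }

theorem displacement_coeFn {m : ℕ} (z : PhaseSpace m) (f : ModeSpace m) :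
    displacement z f =ᵐ[volume] weylFun z f :=
  MemLp.coeFn_toLp (memLp_weylFun z (Lp.memLp f))

theorem norm_displacement {m : ℕ} (z : PhaseSpace m) (f : ModeSpace m) :
    ‖displacement z f‖ = ‖f‖ := by
  change ‖(memLp_weylFun z (Lp.memLp f)).toLp (weylFun z f)‖ = ‖f‖
  rw [Lp.norm_toLp, eLpNorm_weylFun z (Lp.memLp f).1, Lp.norm_def]

/-! ### The displacement operator is the exponential of its generator -/

/-- `V` is a strongly continuous one-parameter unitary group on `L²(ℝ^m)` whose generator
extends `A` on the test functions `C_c^∞(ℝ^m)`. -/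
structure IsUnitaryGroupGeneratedBy {m : ℕ} (A : (Config m → ℂ) → Config m → ℂ)
    (V : ℝ → ModeSpace m →L[ℂ] ModeSpace m) : Prop where
  mem_unitary : ∀ t, V t ∈ unitary (ModeSpace m →L[ℂ] ModeSpace m)
  map_zero : V 0 = 1
  map_add : ∀ s t, V (s + t) = V s * V t
  continuous : ∀ ψ, Continuous fun t => V t ψ
  hasDerivAt : ∀ φ : Config m → ℂ, ContDiff ℝ ∞ φ → HasCompactSupport φ →
    ∀ ψ ξ : ModeSpace m, ψ =ᵐ[volume] φ → ξ =ᵐ[volume] A φ →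
      HasDerivAt (fun t => V t ψ) ξ 0

theorem rePart_smul {m : ℕ} (t : ℝ) (z : PhaseSpace m) : rePart (t • z) = t • rePart z := by
  ext j; simp [rePart]

theorem imPart_smul {m : ℕ} (t : ℝ) (z : PhaseSpace m) : imPart (t • z) = t • imPart z := by
  ext j; simp [imPart]

/-- The canonical commutation relations in Weyl form, along a line. -/
theorem displacement_add_smul {m : ℕ} (z : PhaseSpace m) (s t : ℝ) :
    displacement ((s + t) • z) = displacement (s • z) * displacement (t • z) := by
  ext1 f
  rw [Lp.ext_iff]
  change _ =ᵐ[volume] displacement (s • z) (displacement (t • z) f)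
  refine (displacement_coeFn _ _).trans (EventuallyEq.symm ((displacement_coeFn _ _).trans
    ((weylFun_congr _ (displacement_coeFn _ _)).trans (Eventually.of_forall fun x => ?_))))
  simp only [weylFun, weylPhase, rePart_smul, imPart_smul]
  rw [← mul_assoc, ← Complex.exp_add]
  congr 1
  · congr 1
    rw [← add_mul, ← Complex.ofReal_add]
    congr 2
    simp only [inner_smul_left, inner_smul_right, inner_sub_right, conj_trivial]
    have h2 : Real.sqrt 2 * Real.sqrt 2 = 2 := Real.mul_self_sqrt (by norm_num)
    linear_combination (-(s * t * ⟪imPart z, rePart z⟫_ℝ)) * h2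
  · congr 1
    rw [sub_sub, ← smul_add, ← add_smul]

theorem displacement_zero {m : ℕ} : displacement (0 : PhaseSpace m) = 1 := by
  ext1 f
  rw [Lp.ext_iff]
  refine (displacement_coeFn _ _).trans (Eventually.of_forall fun x => ?_)
  have h1 : rePart (0 : PhaseSpace m) = 0 := by ext j; simp [rePart]
  have h2 : imPart (0 : PhaseSpace m) = 0 := by ext j; simp [imPart]
  simp [weylFun, weylPhase, h1, h2]

theorem displacement_mul_neg {m : ℕ} (z : PhaseSpace m) :
    displacement z * displacement (-z) = 1 := by
  have := displacement_add_smul z 1 (-1)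
  rw [add_neg_cancel, zero_smul, displacement_zero, one_smul, neg_one_smul] at this
  exact this.symm

theorem displacement_mem_unitary {m : ℕ} (z : PhaseSpace m) :
    displacement z ∈ unitary (ModeSpace m →L[ℂ] ModeSpace m) := by
  have h1 : star (displacement z) * displacement z = 1 :=
    (ContinuousLinearMap.norm_map_iff_adjoint_comp_self (displacement z)).1 (norm_displacement z)
  refine Unitary.mem_iff.2 ⟨h1, ?_⟩
  have h2 := displacement_mul_neg z
  have h3 : star (displacement z) = displacement (-z) := by
    calc star (displacement z) = star (displacement z) * (displacement z * displacement (-z)) := by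
          rw [h2, mul_one]
      _ = displacement (-z) := by rw [← mul_assoc, h1, one_mul]
  rw [h3, h2]

theorem displacementGenerator_eq {m : ℕ} (z : PhaseSpace m) (φ : Config m → ℂ) (x : Config m) :
    displacementGenerator z φ x = Real.sqrt 2 * (⟪imPart z, x⟫_ℝ * Complex.I * φ x
      - fderiv ℝ φ x (rePart z)) := by
  have h2 : (Real.sqrt 2 : ℂ) * (Real.sqrt 2 : ℂ) = 2 := by
    rw [← Complex.ofReal_mul, Real.mul_self_sqrt (by norm_num)]; norm_num
  have h0 : (Real.sqrt 2 : ℂ) ≠ 0 := by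
    intro h; rw [h] at h2; norm_num at h2
  have hz : rePart z = ∑ j, (z j).re • EuclideanSpace.single j (1 : ℝ) := by
    ext k
    simp [rePart, Finset.sum_apply, Pi.single_apply]
  have hi : ⟪imPart z, x⟫_ℝ = ∑ j, (z j).im * x j := by
    simp [imPart, PiLp.inner_apply, mul_comm]
  rw [hz, hi, map_sum, Complex.ofReal_sum, Finset.sum_mul, Finset.sum_mul, ← Finset.sum_sub_distrib,
    Finset.mul_sum]
  unfold displacementGenerator creation annihilation position momentum
  refine Finset.sum_congr rfl fun j _ => ?_
  rw [map_smul, Complex.real_smul]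
  generalize fderiv ℝ φ x (EuclideanSpace.single j 1) = d
  have hc : conj (z j) = (z j).re - (z j).im * Complex.I := by
    apply Complex.ext <;> simp
  have hj : z j = (z j).re + (z j).im * Complex.I := (Complex.re_add_im _).symm
  rw [hc]
  generalize (z j).re = a at *
  generalize (z j).im = b at *
  rw [hj]
  field_simp
  push_cast
  linear_combination (-b * x j * Complex.I * φ x + d * a) * h2
    + 2 * d * a * Complex.I_sq

theorem contDiff_weylFun {m : ℕ} (z : PhaseSpace m) {φ : Config m → ℂ} (hφ : ContDiff ℝ ∞ φ) :
    ContDiff ℝ ∞ fun p : ℝ × Config m => weylFun (p.1 • z) φ p.2 := by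
  simp only [weylFun, weylPhase, rePart_smul, imPart_smul, inner_smul_left, inner_smul_right,
    conj_trivial]
  have h1 : ContDiff ℝ ∞ fun p : ℝ × Config m => φ (p.2 - Real.sqrt 2 • p.1 • rePart z) :=
    hφ.comp (by fun_prop)
  refine ContDiff.mul (ContDiff.cexp (ContDiff.mul ?_ contDiff_const)) h1
  refine Complex.ofRealCLM.contDiff.comp (ContDiff.sub ?_ (by fun_prop))
  exact contDiff_const.mul (contDiff_fst.mul (contDiff_const.inner ℝ contDiff_snd))

theorem contDiff_weylFun_right {m : ℕ} (z : PhaseSpace m) {φ : Config m → ℂ}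
    (hφ : ContDiff ℝ ∞ φ) : ContDiff ℝ ∞ (weylFun z φ) := by
  have := (contDiff_weylFun z hφ).comp (contDiff_prodMk_right (𝕜 := ℝ) (n := ∞) (1 : ℝ))
  simpa [Function.comp_def] using this

theorem hasCompactSupport_weylFun {m : ℕ} (z : PhaseSpace m) {φ : Config m → ℂ}
    (hc : HasCompactSupport φ) : HasCompactSupport (weylFun z φ) := by
  refine HasCompactSupport.mul_left ?_
  exact hc.comp_homeomorph (Homeomorph.subRight (Real.sqrt 2 • rePart z))

theorem hasDerivAt_weylFun {m : ℕ} (z : PhaseSpace m) {φ : Config m → ℂ} (hφ : ContDiff ℝ ∞ φ)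
    (x : Config m) :
    HasDerivAt (fun t : ℝ => weylFun (t • z) φ x) (displacementGenerator z φ x) 0 := by
  rw [displacementGenerator_eq]
  simp only [weylFun, weylPhase, rePart_smul, imPart_smul, inner_smul_left, inner_smul_right,
    conj_trivial]
  have hr : HasDerivAt (fun t : ℝ => Real.sqrt 2 * (t * ⟪imPart z, x⟫_ℝ)
      - t * (t * ⟪imPart z, rePart z⟫_ℝ)) (Real.sqrt 2 * ⟪imPart z, x⟫_ℝ) 0 := by
    have h := (((hasDerivAt_id (0 : ℝ)).mul_const ⟪imPart z, x⟫_ℝ).const_mul (Real.sqrt 2)).sub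
      ((hasDerivAt_id (0 : ℝ)).mul ((hasDerivAt_id (0 : ℝ)).mul_const ⟪imPart z, rePart z⟫_ℝ))
    convert! h using 1
    simp
  have hexp := ((hr.ofReal_comp).mul_const Complex.I).cexp
  have hin : HasDerivAt (fun t : ℝ => x - Real.sqrt 2 • t • rePart z)
      (-(Real.sqrt 2 • rePart z)) 0 := by
    have h := (((hasDerivAt_id (0 : ℝ)).smul_const (rePart z)).const_smul (Real.sqrt 2)).const_sub x
    convert! h using 1
    simp
  have hd : DifferentiableAt ℝ φ (x - Real.sqrt 2 • (0 : ℝ) • rePart z) :=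
    (hφ.differentiable (by simp)).differentiableAt
  have hφ' := hd.hasFDerivAt.comp_hasDerivAt (0 : ℝ) hin
  convert! hexp.mul hφ' using 1
  simp
  ring

/-- The displacement operators along a line are differentiable at the origin on test functions,
with derivative the generator. -/
theorem hasDerivAt_displacement {m : ℕ} (z : PhaseSpace m) {φ : Config m → ℂ}
    (hφ : ContDiff ℝ ∞ φ) (hc : HasCompactSupport φ) {ψ ξ : ModeSpace m}
    (hψ : ψ =ᵐ[volume] φ) (hξ : ξ =ᵐ[volume] displacementGenerator z φ) :
    HasDerivAt (fun t : ℝ => displacement (t • z) ψ) ξ 0 := by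
  set G : ℝ → Config m → ℂ := fun t => weylFun (t • z) φ with hG
  have hGs : ContDiff ℝ ∞ fun p : ℝ × Config m => G p.1 p.2 := contDiff_weylFun z hφ
  set K : Set (Config m) :=
    (fun p : ℝ × Config m => p.2 + Real.sqrt 2 • p.1 • rePart z) '' (Set.Icc (-1) 1 ×ˢ tsupport φ)
    with hKdef
  have hK : IsCompact K := (isCompact_Icc.prod hc.isCompact).image (by fun_prop)
  have hzero : ∀ t ∈ Set.Icc (-1 : ℝ) 1, ∀ x ∉ K, G t x = 0 := by
    intro t ht x hx
    have : x - Real.sqrt 2 • t • rePart z ∉ tsupport φ := fun h =>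
      hx ⟨(t, x - Real.sqrt 2 • t • rePart z), ⟨ht, h⟩, by simp⟩
    simp only [hG, weylFun, rePart_smul]
    rw [image_eq_zero_of_notMem_tsupport this, mul_zero]
  set G' : ℝ → Config m → ℂ :=
    fun t x => fderiv ℝ (fun p : ℝ × Config m => G p.1 p.2) (t, x) (1, 0) with hG'
  have hder : ∀ t x, HasDerivAt (fun t => G t x) (G' t x) t := by
    intro t x
    have h1 : HasDerivAt (fun t : ℝ => (t, x)) ((1 : ℝ), (0 : Config m)) t :=
      (hasDerivAt_id t).prodMk (hasDerivAt_const t x)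
    exact ((hGs.differentiable (by simp)).differentiableAt (x := (t, x))).hasFDerivAt.comp_hasDerivAt
      t h1
  have hG'c : Continuous fun p : ℝ × Config m => G' p.1 p.2 :=
    (hGs.continuous_fderiv (by simp)).clm_apply continuous_const
  obtain ⟨C, hC⟩ := (isCompact_Icc (a := (-1 : ℝ)) (b := 1)).prod hK |>.exists_bound_of_continuousOn
    hG'c.continuousOn
  have hG0 : G 0 = φ := by
    ext x
    have h1 : rePart (0 : PhaseSpace m) = 0 := by ext j; simp [rePart]
    have h2 : imPart (0 : PhaseSpace m) = 0 := by ext j; simp [imPart]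
    simp [hG, weylFun, weylPhase, h1, h2]
  have hquot : ∀ t ∈ Set.Icc (-1 : ℝ) 1, ∀ x, ‖t⁻¹ • (G t x - φ x)‖ ≤ K.indicator (fun _ => C) x := by
    intro t ht x
    by_cases hx : x ∈ K
    · rw [Set.indicator_of_mem hx]
      have h0 : (0 : ℝ) ∈ Set.Icc (-1 : ℝ) 1 := by constructor <;> norm_num
      have := (convex_Icc (-1 : ℝ) 1).norm_image_sub_le_of_norm_hasDerivWithin_le
        (f := fun t => G t x) (f' := fun t => G' t x) (C := C)
        (fun s _ => (hder s x).hasDerivWithinAt) (fun s hs => hC (s, x) ⟨hs, hx⟩) h0 ht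
      have hC0 : 0 ≤ C := (norm_nonneg _).trans (hC (0, x) ⟨h0, hx⟩)
      simp only [hG0, sub_zero] at this
      rw [norm_smul, norm_inv]
      rcases eq_or_ne t 0 with rfl | ht0
      · simpa using hC0
      · rw [inv_mul_le_iff₀ (norm_pos_iff.2 ht0), mul_comm]
        exact this
    · have h0 : (0 : ℝ) ∈ Set.Icc (-1 : ℝ) 1 := by constructor <;> norm_num
      rw [Set.indicator_of_notMem hx, hzero t ht x hx, ← hG0, hzero 0 h0 x hx]
      simp
  have hgen : ∀ x, ‖displacementGenerator z φ x‖ ≤ K.indicator (fun _ => C) x := by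
    intro x
    have h := (hasDerivAt_iff_tendsto_slope.1 (hasDerivAt_weylFun z hφ x)).norm
    refine le_of_tendsto h ?_
    have hmem : ∀ᶠ t : ℝ in 𝓝[≠] 0, t ∈ Set.Icc (-1 : ℝ) 1 :=
      nhdsWithin_le_nhds (Icc_mem_nhds (by norm_num) (by norm_num))
    filter_upwards [hmem] with t ht
    have := hquot t ht x
    rw [slope_def_module]
    have e : weylFun ((0 : ℝ) • z) φ x = φ x := congrFun hG0 x
    rw [e]
    simpa using this
  rw [hasDerivAt_iff_tendsto_slope, tendsto_iff_norm_sub_tendsto_zero]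
  have hD0 : displacement ((0 : ℝ) • z) ψ = ψ := by rw [zero_smul, displacement_zero]; rfl
  have hint : ∀ t : ℝ, ‖slope (fun t : ℝ => displacement (t • z) ψ) 0 t - ξ‖ ^ 2
      = ∫ x, ‖t⁻¹ • (G t x - φ x) - displacementGenerator z φ x‖ ^ 2 := by
    intro t
    rw [slope_def_module, hD0, sub_zero]
    rw [← RCLike.ofReal_inj (K := ℂ)]
    push_cast
    rw [← inner_self_eq_norm_sq_to_K (𝕜 := ℂ), L2.inner_def]
    refine Eq.trans ?_ integral_ofReal
    refine integral_congr_ae ?_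
    have e1 : displacement (t • z) ψ =ᵐ[volume] G t :=
      (displacement_coeFn _ _).trans (weylFun_congr _ hψ)
    filter_upwards [Lp.coeFn_sub (t⁻¹ • (displacement (t • z) ψ - ψ)) ξ,
      Lp.coeFn_smul t⁻¹ (displacement (t • z) ψ - ψ), Lp.coeFn_sub (displacement (t • z) ψ) ψ,
      e1, hψ, hξ] with x h1 h2 h3 h4 h5 h6
    rw [inner_self_eq_norm_sq_to_K, h1, Pi.sub_apply, h2, Pi.smul_apply, h3, Pi.sub_apply, h4, h5,
      h6]
    norm_cast
  have hlim : Tendsto (fun t : ℝ => ∫ x, ‖t⁻¹ • (G t x - φ x) - displacementGenerator z φ x‖ ^ 2)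
      (𝓝[≠] 0) (𝓝 0) := by
    have hmem : ∀ᶠ t : ℝ in 𝓝[≠] 0, t ∈ Set.Icc (-1 : ℝ) 1 :=
      nhdsWithin_le_nhds (Icc_mem_nhds (by norm_num) (by norm_num))
    have hAc : AEStronglyMeasurable (displacementGenerator z φ) volume :=
      (Lp.aestronglyMeasurable ξ).congr hξ
    have := tendsto_integral_filter_of_dominated_convergence (μ := (volume : Measure (Config m)))
      (l := 𝓝[≠] (0 : ℝ)) (f := fun _ => (0 : ℝ))
      (F := fun (t : ℝ) x => ‖t⁻¹ • (G t x - φ x) - displacementGenerator z φ x‖ ^ 2)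
      (K.indicator fun _ => (C + C) ^ 2) ?_ ?_ ?_ ?_
    · simpa using this
    · refine Eventually.of_forall fun t => ?_
      have : Continuous (G t) := (contDiff_weylFun_right (t • z) hφ).continuous
      exact ((((this.sub hφ.continuous).const_smul t⁻¹).aestronglyMeasurable.sub hAc).norm.pow 2)
    · filter_upwards [hmem] with t ht
      refine Eventually.of_forall fun x => ?_
      rw [norm_pow, norm_norm]
      have := (norm_sub_le _ _).trans (add_le_add (hquot t ht x) (hgen x))
      refine (pow_le_pow_left₀ (norm_nonneg _) this 2).trans ?_
      by_cases hx : x ∈ K <;> simp [hx]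
    · exact (integrable_indicator_iff hK.measurableSet).2
        (integrableOn_const hK.measure_lt_top.ne)
    · refine Eventually.of_forall fun x => ?_
      have h := hasDerivAt_iff_tendsto_slope.1 (hasDerivAt_weylFun z hφ x)
      have e : weylFun ((0 : ℝ) • z) φ x = φ x := congrFun hG0 x
      have h' := ((h.sub_const (displacementGenerator z φ x)).norm).pow 2
      simp only [slope_def_module, e, sub_zero, sub_self, norm_zero] at h'
      simpa using h'
  have hs := hlim.sqrt
  rw [Real.sqrt_zero] at hs
  refine hs.congr fun t => ?_
  rw [← hint t, Real.sqrt_sq (norm_nonneg _)]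

/-- The smooth compactly supported vectors are dense. -/
theorem exists_test_near {m : ℕ} (ψ : ModeSpace m) {ε : ℝ} (hε : 0 < ε) :
    ∃ (η : ModeSpace m) (φ : Config m → ℂ), η =ᵐ[volume] φ ∧ HasCompactSupport φ ∧
      ContDiff ℝ ∞ φ ∧ dist ψ η < ε := by
  have hd := Lp.dense_hasCompactSupport_contDiff (F := ℂ) (μ := (volume : Measure (Config m)))
    (p := 2) (by simp)
  obtain ⟨η, h4, φ, h1, h2, h3⟩ := Metric.dense_iff.1 hd ψ ε hε
  exact ⟨η, φ, h1, h2, h3, by rw [dist_comm]; exact h4⟩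

/-- The generator maps test functions into `L²`. -/
theorem exists_generator_vector {m : ℕ} (z : PhaseSpace m) {φ : Config m → ℂ}
    (hφ : ContDiff ℝ ∞ φ) (hc : HasCompactSupport φ) :
    ∃ ξ : ModeSpace m, ξ =ᵐ[volume] displacementGenerator z φ := by
  have hcont : Continuous (displacementGenerator z φ) := by
    have h1 : Continuous fun x => fderiv ℝ φ x (rePart z) :=
      (hφ.continuous_fderiv (by simp)).clm_apply continuous_const
    have h2 := hφ.continuous
    have : displacementGenerator z φ = fun x => Real.sqrt 2 * (⟪imPart z, x⟫_ℝ * Complex.I * φ x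
      - fderiv ℝ φ x (rePart z)) := funext (displacementGenerator_eq z φ)
    rw [this]
    fun_prop
  have hsupp : HasCompactSupport (displacementGenerator z φ) := by
    refine hc.mono' fun x hx => ?_
    by_contra h
    apply hx
    rw [displacementGenerator_eq, image_eq_zero_of_notMem_tsupport h]
    have : fderiv ℝ φ x = 0 :=
      Function.notMem_support.1 fun h' => h (support_fderiv_subset ℝ h')
    simp [this]
  have hm := hcont.memLp_of_hasCompactSupport (p := 2) (μ := volume) hsupp
  exact ⟨hm.toLp _, hm.coeFn_toLp⟩

theorem continuous_displacement_smul {m : ℕ} (z : PhaseSpace m) (ψ : ModeSpace m) :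
    Continuous fun t : ℝ => displacement (t • z) ψ := by
  refine continuous_of_uniform_approx_of_continuous fun u hu => ?_
  obtain ⟨ε, hε, hu⟩ := Metric.mem_uniformity_dist.1 hu
  obtain ⟨η, φ, h1, h2, h3, h4⟩ := exists_test_near ψ hε
  refine ⟨fun t => displacement (t • z) η, ?_, fun t => hu ?_⟩
  · obtain ⟨ξ, hξ⟩ := exists_generator_vector z h3 h2
    have h := (hasDerivAt_displacement z h3 h2 h1 hξ).continuousAt
    rw [continuous_iff_continuousAt]
    intro t
    have e : (fun s : ℝ => displacement (s • z) η)
        = fun s => displacement (t • z) (displacement ((s - t) • z) η) := by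
      ext1 s
      change _ = (displacement (t • z) * displacement ((s - t) • z)) η
      rw [← displacement_add_smul, add_sub_cancel]
    rw [e]
    refine (displacement (t • z)).continuous.continuousAt.comp
      (f := fun s : ℝ => displacement ((s - t) • z) η) ?_
    refine ContinuousAt.comp' (f := fun s : ℝ => s - t)
      (g := fun r : ℝ => displacement (r • z) η) ?_ (by fun_prop)
    simpa using h
  · rw [dist_eq_norm, ← map_sub, norm_displacement, ← dist_eq_norm]
    exact h4

theorem isUnitaryGroupGeneratedBy_displacement {m : ℕ} (z : PhaseSpace m) :
    IsUnitaryGroupGeneratedBy (displacementGenerator z) fun t => displacement (t • z) where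
  mem_unitary t := displacement_mem_unitary _
  map_zero := by rw [zero_smul, displacement_zero]
  map_add s t := displacement_add_smul z s t
  continuous ψ := continuous_displacement_smul z ψ
  hasDerivAt _ hφ hc _ _ hψ hξ := hasDerivAt_displacement z hφ hc hψ hξ

theorem IsUnitaryGroupGeneratedBy.inner_map_map {m : ℕ} {A : (Config m → ℂ) → Config m → ℂ}
    {V : ℝ → ModeSpace m →L[ℂ] ModeSpace m} (hV : IsUnitaryGroupGeneratedBy A V) (t : ℝ)
    (u v : ModeSpace m) : ⟪V t u, V t v⟫_ℂ = ⟪u, v⟫_ℂ := by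
  have h : star (V t) * V t = 1 := (Unitary.mem_iff.1 (hV.mem_unitary t)).1
  rw [← ContinuousLinearMap.adjoint_inner_right]
  change ⟪u, (star (V t) * V t) v⟫_ℂ = _
  rw [h]
  rfl

theorem IsUnitaryGroupGeneratedBy.hasDerivAt_apply {m : ℕ}
    {A : (Config m → ℂ) → Config m → ℂ} {V : ℝ → ModeSpace m →L[ℂ] ModeSpace m}
    (hV : IsUnitaryGroupGeneratedBy A V) {φ : Config m → ℂ} (hφ : ContDiff ℝ ∞ φ)
    (hc : HasCompactSupport φ) {ψ ξ : ModeSpace m} (hψ : ψ =ᵐ[volume] φ)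
    (hξ : ξ =ᵐ[volume] A φ) (t : ℝ) : HasDerivAt (fun s => V s ψ) (V t ξ) t := by
  have h := hV.hasDerivAt φ hφ hc ψ ξ hψ hξ
  have e : (fun s => V s ψ) = fun s => V t (V (s - t) ψ) := by
    ext1 s
    change _ = (V t * V (s - t)) ψ
    rw [← hV.map_add, add_sub_cancel]
  rw [e]
  have h1 : HasDerivAt (fun s => V (s - t) ψ) ξ t := by
    refine HasDerivAt.comp_sub_const (f := fun r => V r ψ) t t ?_
    rw [sub_self]
    exact h
  have h2 : HasFDerivAt (V t) ((V t).restrictScalars ℝ) (V (t - t) ψ) :=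
    ((V t).restrictScalars ℝ).hasFDerivAt
  exact h2.comp_hasDerivAt t h1

/-- `t ↦ D(t z)` is the one and only strongly continuous one-parameter unitary group whose
generator extends `∑_j (z_j a_j† - z_j^* a_j)` on `C_c^∞(ℝ^m)`; in particular `D(z)`, its value at
`t = 1`, is the exponential of that operator. -/
theorem isUnitaryGroupGeneratedBy_iff {m : ℕ} (z : PhaseSpace m)
    (V : ℝ → ModeSpace m →L[ℂ] ModeSpace m) :
    IsUnitaryGroupGeneratedBy (displacementGenerator z) V ↔ ∀ t, V t = displacement (t • z) := by
  refine ⟨fun hV => ?_, fun h => ?_⟩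
  swap
  · rw [show V = fun t => displacement (t • z) from funext h]
    exact isUnitaryGroupGeneratedBy_displacement z
  have hD := isUnitaryGroupGeneratedBy_displacement z
  -- the two groups agree on test functions
  have key : ∀ (φ : Config m → ℂ), ContDiff ℝ ∞ φ → HasCompactSupport φ →
      ∀ ψ : ModeSpace m, ψ =ᵐ[volume] φ → ∀ t, V t ψ = displacement (t • z) ψ := by
    intro φ hφ hc ψ hψ t
    obtain ⟨ξ, hξ⟩ := exists_generator_vector z hφ hc
    have hder : ∀ t : ℝ, HasDerivAt (fun s => ⟪V s ψ, displacement (s • z) ψ⟫_ℂ) 0 t := by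
      intro t
      have hVt := hV.hasDerivAt_apply hφ hc hψ hξ t
      have hDt := hD.hasDerivAt_apply hφ hc hψ hξ t
      set u := displacement (t • z) ψ with hu
      have huφ : u =ᵐ[volume] weylFun (t • z) φ :=
        (displacement_coeFn _ _).trans (weylFun_congr _ hψ)
      have hws := contDiff_weylFun_right (t • z) hφ
      have hwc := hasCompactSupport_weylFun (t • z) hc
      obtain ⟨ζ, hζ⟩ := exists_generator_vector z hws hwc
      -- the derivative of the second group at `u`, in two ways
      have hζ' : displacement (t • z) ξ = ζ := by
        have h1 : HasDerivAt (fun s : ℝ => displacement (s • z) u) ζ 0 :=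
          hD.hasDerivAt _ hws hwc u ζ huφ hζ
        have h2 : HasDerivAt (fun s : ℝ => displacement (t • z) (displacement (s • z) ψ))
            (displacement (t • z) ξ) 0 :=
          ((displacement (t • z)).restrictScalars ℝ).hasFDerivAt.comp_hasDerivAt 0
            (hasDerivAt_displacement z hφ hc hψ hξ)
        refine h2.unique ?_
        convert! h1 using 1
        ext1 s
        change (displacement (t • z) * displacement (s • z)) ψ
          = (displacement (s • z) * displacement (t • z)) ψ
        rw [← displacement_add_smul, ← displacement_add_smul, add_comm]
      -- skew symmetry of the generator of the first group
      have hskew : ⟪V t ξ, u⟫_ℂ + ⟪V t ψ, ζ⟫_ℂ = 0 := by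
        have h1 : HasDerivAt (fun s : ℝ => V s (V t ψ)) (V t ξ) 0 := by
          have h := ((V t).restrictScalars ℝ).hasFDerivAt.comp_hasDerivAt 0
            (hV.hasDerivAt φ hφ hc ψ ξ hψ hξ)
          convert! h using 1
          ext1 s
          change (V s * V t) ψ = (V t * V s) ψ
          rw [← hV.map_add, ← hV.map_add, add_comm]
        have h2 : HasDerivAt (fun s : ℝ => V s u) ζ 0 :=
          hV.hasDerivAt _ hws hwc u ζ huφ hζ
        have h3 := h1.inner ℂ h2
        have e0 : ∀ v, V 0 v = v := fun v => by rw [hV.map_zero]; rfl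
        simp only [hV.inner_map_map, e0] at h3
        rw [add_comm]
        exact (h3.unique (hasDerivAt_const _ _))
      have h4 := hVt.inner ℂ hDt
      rw [← hu] at h4
      convert! h4 using 1
      rw [hζ', add_comm]
      exact hskew.symm
    have hconst := is_const_of_deriv_eq_zero (fun t => (hder t).differentiableAt)
      (fun t => (hder t).deriv) t 0
    have e0 : V 0 ψ = ψ := by rw [hV.map_zero]; rfl
    have e1 : displacement ((0 : ℝ) • z) ψ = ψ := by rw [zero_smul, displacement_zero]; rfl
    rw [e0, e1] at hconst
    have hn : ‖V t ψ‖ ^ 2 = ‖ψ‖ ^ 2 := by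
      rw [← inner_self_eq_norm_sq (𝕜 := ℂ), hV.inner_map_map, inner_self_eq_norm_sq (𝕜 := ℂ)]
    rw [← sub_eq_zero, ← norm_eq_zero, ← sq_eq_zero_iff, norm_sub_sq (𝕜 := ℂ), hn,
      norm_displacement, hconst, inner_self_eq_norm_sq (𝕜 := ℂ)]
    ring
  intro t
  ext1 ψ
  have hclosed : IsClosed {ψ : ModeSpace m | V t ψ = displacement (t • z) ψ} :=
    isClosed_eq (V t).continuous (displacement (t • z)).continuous
  have hd := Lp.dense_hasCompactSupport_contDiff (F := ℂ) (μ := (volume : Measure (Config m)))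
    (p := 2) (by simp)
  refine closure_minimal (fun η hη => ?_) hclosed (hd ψ)
  obtain ⟨φ, h1, h2, h3⟩ := hη
  exact key φ h3 h2 η h1 t

/-! ### Traces, states and characteristic functions -/

universe u

/-- `T` is trace class with trace `c`: the sum `∑_i ⟨b_i, T b_i⟩` converges (unconditionally, hence
absolutely) to `c` in every orthonormal basis `b`. -/
def HasTrace {H : Type u} [NormedAddCommGroup H] [InnerProductSpace ℂ H]
    (T : H →L[ℂ] H) (c : ℂ) : Prop :=
  ∀ (ι : Type u) (b : HilbertBasis ι ℂ H), HasSum (fun i => ⟪b i, T (b i)⟫_ℂ) c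

/-- The trace `Tr T = ∑_i ⟨b_i, T b_i⟩` of a trace class operator `T`, computed in some fixed
orthonormal basis `b`. (It is only meaningful, and then independent of `b`, if `T` is trace
class.) -/
def trace {H : Type u} [NormedAddCommGroup H] [InnerProductSpace ℂ H] [CompleteSpace H]
    (T : H →L[ℂ] H) : ℂ :=
  ∑' i, ⟪(exists_hilbertBasis ℂ H).choose_spec.choose i,
    T ((exists_hilbertBasis ℂ H).choose_spec.choose i)⟫_ℂ

theorem HasTrace.trace_eq {H : Type u} [NormedAddCommGroup H] [InnerProductSpace ℂ H]
    [CompleteSpace H] {T : H →L[ℂ] H} {c : ℂ} (h : HasTrace T c) : trace T = c :=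
  (h _ _).tsum_eq

/-- An `m`-mode quantum state (density operator): a positive semi-definite trace class operator
on `L²(ℝ^m)` with unit trace. -/
structure IsState {m : ℕ} (ρ : ModeSpace m →L[ℂ] ModeSpace m) : Prop where
  isPositive : ρ.IsPositive
  hasTrace_one : HasTrace ρ 1

/-- The quantum characteristic function `χ_T(z) = Tr[T D(z)]`. -/
def characteristicFunction {m : ℕ} (T : ModeSpace m →L[ℂ] ModeSpace m) (z : PhaseSpace m) : ℂ :=
  trace (T * displacement z)

end QuantumCF

end

/-! Everything reduces to pure states. Taking `√ρ` on a Hilbert basis gives `ρ = ∑ |w_k⟩⟨w_k|` with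
`∑ ‖w_k‖² = 1` (`exists_rankOne_decomposition`), and then `χ_ρ(z) = ∑ ⟨w_k, D(z) w_k⟩`
(`hasTrace_mul_of_rankOne_decomposition`). Since `D(z)` is unitary, the k-th term is at most
`‖w_k‖²` uniformly in `z`, so continuity and decay pass from the terms to the sum.

For a single vector `v`, decay of `⟨v, D(z) v⟩` is a Riemann–Lebesgue argument without Fourier
transforms: for large `z` there is a small `w` such that `D(w)` anticommutes with `D(z)`. Replacing
`v` by `D(w) v` flips the sign of the coefficient while hardly moving `v`, so the coefficient is
small (`tendsto_inner_displacement_cocompact`).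

The strict bound follows from decay. Equality in Cauchy–Schwarz would make `v` an eigenvector of
`D(z)`, hence of every `D(n z)`, and the coefficient could not decay along `n z`
(`norm_inner_displacement_lt`). Finally, a continuous function vanishing at infinity attains its
maximum modulus on a nonempty closed set, so the pointwise bound gives a bound on the supremum. -/

noncomputable section

namespace QuantumCF

/-! ### Positive trace class operators as sums of rank one operators -/

section Trace

universe v

variable {H : Type v} [NormedAddCommGroup H] [InnerProductSpace ℂ H] [CompleteSpace H]

/-- A positive trace class operator is a sum `∑_k |v_k⟩⟨v_k|` with `∑_k ‖v_k‖² = Tr ρ`. -/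
theorem exists_rankOne_decomposition {ρ : H →L[ℂ] H} (hρ : ρ.IsPositive) {c : ℝ}
    (hc : HasTrace ρ c) :
    ∃ (ι : Type v) (w : ι → H), HasSum (fun k => ‖w k‖ ^ 2) c ∧
      ∀ x y, HasSum (fun k => ⟪x, w k⟫_ℂ * ⟪w k, y⟫_ℂ) ⟪x, ρ y⟫_ℂ := by
  have h0 : 0 ≤ ρ := (ContinuousLinearMap.nonneg_iff_isPositive ρ).2 hρ
  set S := CFC.sqrt ρ
  have hSS : S * S = ρ := CFC.sqrt_mul_sqrt_self ρ h0
  have hS : S.IsPositive :=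
    (ContinuousLinearMap.nonneg_iff_isPositive S).1 (CFC.sqrt_nonneg ρ)
  have hsymm : ∀ x y, ⟪S x, y⟫_ℂ = ⟪x, S y⟫_ℂ := hS.isSymmetric
  have hSρ : ∀ x y, ⟪x, ρ y⟫_ℂ = ⟪S x, S y⟫_ℂ := fun x y => by
    rw [hsymm, ← hSS]
    rfl
  obtain ⟨w, b, -⟩ := exists_hilbertBasis ℂ H
  -- The vectors `S (b k)` need not be orthogonal, so no spectral decomposition is needed: the trace
  -- in the basis `b` gives their norms, and Parseval for `⟪S x, S y⟫` gives the matrix elements.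
  refine ⟨w, fun k => S (b k), ?_, fun x y => ?_⟩
  · have h := hc w b
    rw [← Complex.hasSum_ofReal]
    refine h.congr_fun fun k => ?_
    rw [hSρ, inner_self_eq_norm_sq_to_K]
    push_cast
    rfl
  · rw [hSρ]
    simpa only [hsymm] using b.hasSum_inner_mul_inner (S x) (S y)

/-- If `ρ = ∑_k |v_k⟩⟨v_k|` with `∑_k ‖v_k‖² < ∞` then `ρ U` is trace class for every bounded `U`,
with trace `∑_k ⟨v_k, U v_k⟩`. -/
theorem hasTrace_mul_of_rankOne_decomposition {ρ : H →L[ℂ] H} {κ : Type*} {w : κ → H}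
    (hw : Summable fun k => ‖w k‖ ^ 2)
    (hρ : ∀ x y, HasSum (fun k => ⟪x, w k⟫_ℂ * ⟪w k, y⟫_ℂ) ⟪x, ρ y⟫_ℂ) (U : H →L[ℂ] H) :
    HasTrace (ρ * U) (∑' k, ⟪w k, U (w k)⟫_ℂ) := by
  intro ι b
  set Ua := ContinuousLinearMap.adjoint U
  -- Summed over `i`, this double family gives `⟪w k, U (w k)⟫` by Parseval; summed over `k`, it
  -- gives the diagonal entry `⟪b i, ρ U (b i)⟫`. The claim is that the two orders of summation
  -- agree.
  set F : κ × ι → ℂ := fun p => ⟪Ua (w p.1), b p.2⟫_ℂ * ⟪b p.2, w p.1⟫_ℂ with hF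
  have hsq : ∀ x : H, HasSum (fun i => ‖⟪b i, x⟫_ℂ‖ ^ 2) (‖x‖ ^ 2) := fun x => by
    have h := b.hasSum_inner_mul_inner x x
    rw [inner_self_eq_norm_sq_to_K] at h
    rw [← Complex.hasSum_ofReal]
    push_cast
    refine h.congr_fun fun i => ?_
    rw [← inner_conj_symm x (b i), ← Complex.normSq_eq_conj_mul_self, Complex.normSq_eq_norm_sq]
    push_cast
    rfl
  -- Majorant of `F` from `|a b| ≤ |a|² + |b|²`; its total is at most `(‖Ua‖² + 1) ∑ ‖w k‖²`, which
  -- justifies the interchange.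
  set G : κ × ι → ℝ := fun p => ‖⟪b p.2, Ua (w p.1)⟫_ℂ‖ ^ 2 + ‖⟪b p.2, w p.1⟫_ℂ‖ ^ 2 with hG
  have hG0 : 0 ≤ G := fun p => add_nonneg (sq_nonneg _) (sq_nonneg _)
  have hGrow : ∀ k, HasSum (fun i => G (k, i)) (‖Ua (w k)‖ ^ 2 + ‖w k‖ ^ 2) := fun k =>
    (hsq (Ua (w k))).add (hsq (w k))
  have hGs : Summable G := by
    refine (summable_prod_of_nonneg hG0).2 ⟨fun k => (hGrow k).summable, ?_⟩
    rw [funext fun k => (hGrow k).tsum_eq]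
    refine Summable.of_nonneg_of_le (fun k => add_nonneg (sq_nonneg _) (sq_nonneg _)) (fun k => ?_)
      ((hw.mul_left (‖Ua‖ ^ 2)).add hw)
    refine add_le_add_left ?_ _
    rw [← mul_pow]
    exact pow_le_pow_left₀ (norm_nonneg _) (Ua.le_opNorm _) 2
  have hFs : Summable F := by
    refine Summable.of_norm_bounded hGs fun p => ?_
    simp only [hF, hG]
    rw [norm_mul, norm_inner_symm]
    nlinarith [two_mul_le_add_sq ‖⟪b p.2, Ua (w p.1)⟫_ℂ‖ ‖⟪b p.2, w p.1⟫_ℂ‖,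
      mul_nonneg (norm_nonneg ⟪b p.2, Ua (w p.1)⟫_ℂ) (norm_nonneg ⟪b p.2, w p.1⟫_ℂ)]
  have hadj : ∀ x y, ⟪Ua x, y⟫_ℂ = ⟪x, U y⟫_ℂ := fun x y =>
    ContinuousLinearMap.adjoint_inner_left U y x
  have hFrow : ∀ k, HasSum (fun i => F (k, i)) ⟪w k, U (w k)⟫_ℂ := fun k =>
    hadj (w k) (w k) ▸ b.hasSum_inner_mul_inner (Ua (w k)) (w k)
  have hrow : HasSum (fun k => ⟪w k, U (w k)⟫_ℂ) (∑' p, F p) :=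
    hFs.hasSum.prod_fiberwise hFrow
  have hcol : HasSum (fun q : ι × κ => F (q.2, q.1)) (∑' p, F p) :=
    (Equiv.prodComm ι κ).hasSum_iff.2 hFs.hasSum
  have hfib : ∀ i, HasSum (fun k => F (k, i)) ⟪b i, (ρ * U) (b i)⟫_ℂ := fun i => by
    refine (hρ (b i) (U (b i))).congr_fun fun k => ?_
    simp only [hF]
    rw [hadj, mul_comm]
  rw [hrow.tsum_eq]
  exact hcol.prod_fiberwise hfib

end Trace

/-! ### Matrix coefficients of the displacement operators -/

variable {m : ℕ}

theorem norm_inner_displacement_le (z : PhaseSpace m) (v : ModeSpace m) :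
    ‖⟪v, displacement z v⟫_ℂ‖ ≤ ‖v‖ ^ 2 := by
  refine (norm_inner_le_norm _ _).trans ?_
  rw [norm_displacement, sq]

theorem continuous_rePart : Continuous (rePart : PhaseSpace m → Config m) := by
  unfold rePart
  fun_prop

theorem continuous_imPart : Continuous (imPart : PhaseSpace m → Config m) := by
  unfold imPart
  fun_prop

/-- Dominated convergence: the integrand is continuous in `z` for each fixed `x`, and the phase has
modulus one, so `‖φ x‖ * sup ‖φ‖` dominates it for all `z`. -/
theorem continuous_inner_displacement_of_hasCompactSupport {φ : Config m → ℂ} (hφ : Continuous φ)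
    (hc : HasCompactSupport φ) {η : ModeSpace m} (hη : η =ᵐ[volume] φ) :
    Continuous fun z : PhaseSpace m => ⟪η, displacement z η⟫_ℂ := by
  have e : ∀ z : PhaseSpace m, ⟪η, displacement z η⟫_ℂ = ∫ x, ⟪φ x, weylFun z φ x⟫_ℂ := fun z => by
    rw [L2.inner_def]
    refine integral_congr_ae ?_
    filter_upwards [hη, (displacement_coeFn z η).trans (weylFun_congr z hη)] with x h1 h2
    rw [h1, h2]
  simp only [e]
  obtain ⟨C, hC⟩ := hφ.bounded_above_of_compact_support hc
  have hcont : ∀ z : PhaseSpace m, Continuous (weylFun z φ) := fun z =>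
    (continuous_weylPhase z).mul (hφ.comp (by fun_prop))
  refine continuous_of_dominated (bound := fun x => ‖φ x‖ * C) (fun z => ?_) (fun z => ?_) ?_ ?_
  · exact (hφ.inner (hcont z)).aestronglyMeasurable
  · refine Eventually.of_forall fun x => (norm_inner_le_norm _ _).trans ?_
    gcongr
    simpa [weylFun, norm_weylPhase] using hC _
  · exact (hφ.norm.integrable_of_hasCompactSupport hc.norm).mul_const C
  · refine Eventually.of_forall fun x => continuous_const.inner ?_
    have h1 := continuous_rePart (m := m)
    have h2 := continuous_imPart (m := m)
    refine Continuous.mul ?_ (hφ.comp (by fun_prop))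
    unfold weylPhase
    fun_prop

/-- Test vectors are dense and `D(z)` is isometric, so replacing `v` by a nearby `u` costs at most
`‖v - u‖ (‖v‖ + ‖u‖)` uniformly in `z`. A uniform limit of continuous functions is continuous. -/
theorem continuous_inner_displacement (v : ModeSpace m) :
    Continuous fun z : PhaseSpace m => ⟪v, displacement z v⟫_ℂ := by
  have hc : Dense {f : ModeSpace m | ∃ g : Config m → ℂ,
      f =ᵐ[volume] g ∧ HasCompactSupport g ∧ ContDiff ℝ ∞ g} :=
    Lp.dense_hasCompactSupport_contDiff (by simp)
  obtain ⟨u, hu, hlim⟩ := mem_closure_iff_seq_limit.1 (hc v)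
  have hn : Tendsto (fun n => ‖v - u n‖ * (‖v‖ + ‖u n‖)) atTop (𝓝 0) := by
    have h := ((tendsto_const_nhds (x := v)).sub hlim).norm.mul (hlim.norm.const_add ‖v‖)
    simpa using h
  have hU : TendstoUniformly (fun n z => ⟪u n, displacement z (u n)⟫_ℂ)
      (fun z : PhaseSpace m => ⟪v, displacement z v⟫_ℂ) atTop := by
    rw [Metric.tendstoUniformly_iff]
    intro ε hε
    filter_upwards [hn.eventually (gt_mem_nhds hε)] with n hn z
    refine lt_of_le_of_lt ?_ hn
    have e : ⟪v, displacement z v⟫_ℂ - ⟪u n, displacement z (u n)⟫_ℂ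
        = ⟪v, displacement z (v - u n)⟫_ℂ + ⟪v - u n, displacement z (u n)⟫_ℂ := by
      rw [map_sub, inner_sub_right, inner_sub_left]
      ring
    rw [dist_eq_norm, e]
    refine (norm_add_le _ _).trans
      ((add_le_add (norm_inner_le_norm _ _) (norm_inner_le_norm _ _)).trans_eq ?_)
    rw [norm_displacement, norm_displacement]
    ring
  refine hU.continuous (Frequently.of_forall fun n => ?_)
  obtain ⟨φ, h1, h2, h3⟩ := hu n
  exact continuous_inner_displacement_of_hasCompactSupport h3.continuous h2 h1

/-- Strong continuity of the displacement operators at the origin. -/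
theorem tendsto_norm_displacement_sub (v : ModeSpace m) :
    Tendsto (fun z : PhaseSpace m => ‖displacement z v - v‖) (𝓝 0) (𝓝 0) := by
  -- For isometries, strong continuity at the origin reduces to continuity of the matrix
  -- coefficient.
  have h : ∀ z : PhaseSpace m, ‖displacement z v - v‖
      = √(2 * ‖v‖ ^ 2 - 2 * (⟪v, displacement z v⟫_ℂ).re) := fun z => by
    rw [← Real.sqrt_sq (norm_nonneg (displacement z v - v)), norm_sub_sq (𝕜 := ℂ),
      norm_displacement, ← inner_conj_symm]
    congr 1
    simp only [RCLike.re_to_complex, Complex.conj_re]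
    ring
  simp only [h]
  have hc : Continuous fun z : PhaseSpace m =>
      √(2 * ‖v‖ ^ 2 - 2 * (⟪v, displacement z v⟫_ℂ).re) := by
    have := continuous_inner_displacement v
    fun_prop
  refine (hc.tendsto 0).trans_eq ?_
  have h0 : displacement (0 : PhaseSpace m) v = v := by rw [displacement_zero]; rfl
  rw [← h, h0, sub_self, norm_zero]

/-! ### Commutation relations and decay at infinity. -/

/-- The canonical commutation relations in Weyl form. -/
theorem displacement_comm (z w : PhaseSpace m) (f : ModeSpace m) :
    displacement z (displacement w f)
      = Complex.exp (((2 * (⟪imPart z, rePart w⟫_ℝ - ⟪imPart w, rePart z⟫_ℝ) : ℝ) : ℂ) * Complex.I) •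
        displacement w (displacement z f) := by
  have hcomp : ∀ a b : PhaseSpace m,
      displacement a (displacement b f) =ᵐ[volume] weylFun a (weylFun b f) := fun a b =>
    (displacement_coeFn _ _).trans (weylFun_congr _ (displacement_coeFn _ _))
  rw [Lp.ext_iff]
  filter_upwards [hcomp z w, hcomp w z, Lp.coeFn_smul (Complex.exp
    (((2 * (⟪imPart z, rePart w⟫_ℝ - ⟪imPart w, rePart z⟫_ℝ) : ℝ) : ℂ) * Complex.I))
    (displacement w (displacement z f))] with x h1 h2 h3
  rw [h1, h3, Pi.smul_apply, h2, smul_eq_mul]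
  simp only [weylFun, weylPhase]
  rw [← mul_assoc, ← mul_assoc, ← mul_assoc, ← Complex.exp_add, ← Complex.exp_add,
    ← Complex.exp_add, sub_right_comm]
  congr 2
  rw [← add_mul, ← add_mul, ← add_mul, ← Complex.ofReal_add, ← Complex.ofReal_add,
    ← Complex.ofReal_add]
  congr 2
  simp only [inner_smul_right, inner_sub_right]
  have h2 : Real.sqrt 2 * Real.sqrt 2 = 2 := Real.mul_self_sqrt (by norm_num)
  linear_combination (⟪imPart z, rePart w⟫_ℝ - ⟪imPart w, rePart z⟫_ℝ) * h2

theorem norm_sq_eq_rePart_add_imPart (z : PhaseSpace m) :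
    ‖z‖ ^ 2 = ⟪rePart z, rePart z⟫_ℝ + ⟪imPart z, imPart z⟫_ℝ := by
  rw [EuclideanSpace.norm_sq_eq, PiLp.inner_apply, PiLp.inner_apply, ← Finset.sum_add_distrib]
  refine Finset.sum_congr rfl fun j _ => ?_
  rw [← Complex.normSq_eq_norm_sq, Complex.normSq_apply]
  simp [rePart, imPart, sq]

/-- A displacement of length `π / (2 |z|)` whose Weyl operator anticommutes with that of `z`. -/
def conjugateShift (z : PhaseSpace m) : PhaseSpace m :=
  (((Real.pi / (2 * ‖z‖ ^ 2) : ℝ) : ℂ) * Complex.I) • z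

theorem displacement_conjugateShift {z : PhaseSpace m} (hz : z ≠ 0) (f : ModeSpace m) :
    displacement z (displacement (conjugateShift z) f)
      = -displacement (conjugateShift z) (displacement z f) := by
  have hr : rePart (conjugateShift z) = -((Real.pi / (2 * ‖z‖ ^ 2)) • imPart z) := by
    ext j
    simp [rePart, imPart, conjugateShift, Complex.mul_re, Complex.mul_im, -Complex.ofReal_div]
  have hi : imPart (conjugateShift z) = (Real.pi / (2 * ‖z‖ ^ 2)) • rePart z := by
    ext j
    simp [rePart, imPart, conjugateShift, Complex.mul_re, Complex.mul_im, -Complex.ofReal_div]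
  have hz' : ‖z‖ ≠ 0 := norm_ne_zero_iff.2 hz
  -- The symplectic form of `z` with `i c z` is `-c ‖z‖²`; the choice `c = π / (2 ‖z‖²)` makes the
  -- Weyl phase `exp(-iπ) = -1`.
  have e : 2 * (⟪imPart z, rePart (conjugateShift z)⟫_ℝ - ⟪imPart (conjugateShift z), rePart z⟫_ℝ)
      = -Real.pi := by
    rw [hr, hi, inner_neg_right, inner_smul_right, real_inner_smul_left]
    have h := norm_sq_eq_rePart_add_imPart z
    field_simp
    linear_combination h
  rw [displacement_comm, e, Complex.ofReal_neg, neg_mul, Complex.exp_neg, Complex.exp_pi_mul_I]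
  simp

theorem tendsto_conjugateShift :
    Tendsto (conjugateShift : PhaseSpace m → PhaseSpace m) (cocompact _) (𝓝 0) := by
  rw [tendsto_zero_iff_norm_tendsto_zero]
  have h : Tendsto (fun z : PhaseSpace m => Real.pi / 2 * ‖z‖⁻¹) (cocompact _) (𝓝 0) := by
    simpa using (tendsto_inv_atTop_zero.comp
      (tendsto_norm_cocompact_atTop (E := PhaseSpace m))).const_mul (Real.pi / 2)
  refine h.congr fun z => ?_
  rw [conjugateShift, norm_smul, norm_mul, Complex.norm_I, mul_one, Complex.norm_real,
    Real.norm_of_nonneg (by positivity)]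
  -- At the origin both sides are zero, by the convention for division by zero.
  rcases eq_or_ne ‖z‖ 0 with h0 | h0
  · simp [h0]
  · field_simp

/-- With `w = conjugateShift z` and `g = D(w) v`, anticommutation makes the coefficient at `g` the
negative of the one at `v`. Hence `|⟪v, D(z) v⟫| ≤ ‖v‖ ‖g - v‖`, which tends to zero because `w → 0`
as `z → ∞`. -/
theorem tendsto_inner_displacement_cocompact (v : ModeSpace m) :
    Tendsto (fun z : PhaseSpace m => ⟪v, displacement z v⟫_ℂ) (cocompact _) (𝓝 0) := by
  have hlim := ((tendsto_norm_displacement_sub v).comp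
    (tendsto_conjugateShift (m := m))).const_mul ‖v‖
  rw [mul_zero] at hlim
  have hne : ∀ᶠ z : PhaseSpace m in cocompact _, z ≠ 0 := by
    filter_upwards [tendsto_norm_cocompact_atTop.eventually_gt_atTop 0] with z hz
    exact norm_pos_iff.1 hz
  refine squeeze_zero_norm' ?_ hlim
  filter_upwards [hne] with z hz
  set w := conjugateShift z
  set g := displacement w v
  have hg : ‖g‖ = ‖v‖ := norm_displacement w v
  have h1 : ⟪g, displacement z g⟫_ℂ = -⟪v, displacement z v⟫_ℂ := by
    rw [displacement_conjugateShift hz, inner_neg_right]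
    congr 1
    -- Invariance of the inner product under `D(w)`, taken from the group `t ↦ D(t w)` at `t = 1`.
    simpa using (isUnitaryGroupGeneratedBy_displacement w).inner_map_map 1 v (displacement z v)
  have h2 : 2 * ⟪v, displacement z v⟫_ℂ
      = -(⟪g - v, displacement z g⟫_ℂ + ⟪v, displacement z (g - v)⟫_ℂ) := by
    rw [map_sub, inner_sub_left, inner_sub_right]
    linear_combination h1
  have h3 : 2 * ‖⟪v, displacement z v⟫_ℂ‖ ≤ 2 * (‖v‖ * ‖g - v‖) := by
    calc 2 * ‖⟪v, displacement z v⟫_ℂ‖ = ‖2 * ⟪v, displacement z v⟫_ℂ‖ := by simp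
      _ ≤ ‖g - v‖ * ‖displacement z g‖ + ‖v‖ * ‖displacement z (g - v)‖ := by
        rw [h2, norm_neg]
        exact (norm_add_le _ _).trans (add_le_add (norm_inner_le_norm _ _) (norm_inner_le_norm _ _))
      _ = 2 * (‖v‖ * ‖g - v‖) := by
        rw [norm_displacement, norm_displacement z (g - v), hg]
        ring
  exact le_of_mul_le_mul_left h3 two_pos

/-- Equality in Cauchy–Schwarz forces `D(z) v = r v` with `|r| = 1`, hence `D(n z) v = r ^ n v`. The
coefficient then has constant modulus `‖v‖² ≠ 0` along `n z → ∞`, against its decay. -/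
theorem norm_inner_displacement_lt {z : PhaseSpace m} (hz : z ≠ 0) {v : ModeSpace m} (hv : v ≠ 0) :
    ‖⟪v, displacement z v⟫_ℂ‖ < ‖v‖ ^ 2 := by
  refine lt_of_le_of_ne (norm_inner_displacement_le z v) fun heq => ?_
  have hv0 : ‖v‖ ≠ 0 := norm_ne_zero_iff.2 hv
  have hne : displacement z v ≠ 0 := by
    rw [← norm_ne_zero_iff, norm_displacement]
    exact hv0
  obtain ⟨r, -, hr⟩ := (norm_inner_eq_norm_iff hv hne).1
    (by rw [heq, norm_displacement, sq])
  have hr1 : ‖r‖ = 1 := by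
    have h := norm_displacement z v
    rw [hr, norm_smul] at h
    exact mul_right_cancel₀ hv0 (h.trans (one_mul _).symm)
  have hpow : ∀ n : ℕ, displacement ((n : ℝ) • z) v = r ^ n • v := by
    intro n
    induction n with
    | zero => rw [Nat.cast_zero, zero_smul, displacement_zero, pow_zero, one_smul]; rfl
    | succ n ih =>
      rw [Nat.cast_succ, displacement_add_smul, one_smul]
      change displacement ((n : ℝ) • z) (displacement z v) = _
      rw [hr, map_smul, ih, smul_smul, pow_succ']
  have hco : Tendsto (fun n : ℕ => (n : ℝ) • z) atTop (cocompact (PhaseSpace m)) := by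
    rw [← Metric.cobounded_eq_cocompact, ← tendsto_norm_atTop_iff_cobounded]
    simp only [norm_smul, Real.norm_natCast]
    exact tendsto_natCast_atTop_atTop.atTop_mul_const (norm_pos_iff.2 hz)
  have hlim := ((tendsto_inner_displacement_cocompact v).comp hco).norm
  have hconst : ∀ n : ℕ, ‖⟪v, displacement ((n : ℝ) • z) v⟫_ℂ‖ = ‖v‖ ^ 2 := fun n => by
    rw [hpow, inner_smul_right, norm_mul, norm_pow, hr1, one_pow, one_mul,
      inner_self_eq_norm_sq_to_K]
    simp
  simp only [Function.comp_def, hconst, norm_zero] at hlim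
  have := tendsto_nhds_unique hlim tendsto_const_nhds
  exact hv0 (pow_eq_zero_iff two_ne_zero |>.1 this.symm)

end QuantumCF

end

/-! ### From pure states to a general state. -/

theorem mainTheorem7 (m : ℕ) (ρ : QuantumCF.ModeSpace m →L[ℂ] QuantumCF.ModeSpace m)
    (hρ : QuantumCF.IsState ρ) :
    -- `ρ D(z)` is trace class, so that `χ_ρ(z) = Tr[ρ D(z)]` is well defined
    (∀ z : QuantumCF.PhaseSpace m,
      QuantumCF.HasTrace (ρ * QuantumCF.displacement z) (QuantumCF.characteristicFunction ρ z)) ∧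
    -- `χ_ρ` belongs to `C₀(ℂ^m)`
    (∃ g : C₀(QuantumCF.PhaseSpace m, ℂ), ⇑g = QuantumCF.characteristicFunction ρ) ∧
    -- `sup_{|z| ≥ ε} |χ_ρ(z)| < 1` for every `ε > 0`
    (∀ ε : ℝ, 0 < ε →
      BddAbove ((fun z => ‖QuantumCF.characteristicFunction ρ z‖) ''
        {z : QuantumCF.PhaseSpace m | ε ≤ ‖z‖}) ∧
      sSup ((fun z => ‖QuantumCF.characteristicFunction ρ z‖) ''
        {z : QuantumCF.PhaseSpace m | ε ≤ ‖z‖}) < 1) := by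
  obtain ⟨κ, w, hw, hdec⟩ := QuantumCF.exists_rankOne_decomposition hρ.isPositive (c := 1)
    (by simpa using hρ.hasTrace_one)
  have htr := fun z : QuantumCF.PhaseSpace m =>
    QuantumCF.hasTrace_mul_of_rankOne_decomposition hw.summable hdec (QuantumCF.displacement z)
  set χ := QuantumCF.characteristicFunction ρ
  have hχ : ∀ z, χ z = ∑' k, ⟪w k, QuantumCF.displacement z (w k)⟫_ℂ := fun z =>
    (htr z).trace_eq
  -- A summable majorant independent of `z`; it serves for continuity, for decay and for the bound
  -- by one.
  have hbound : ∀ k z, ‖⟪w k, QuantumCF.displacement z (w k)⟫_ℂ‖ ≤ ‖w k‖ ^ 2 := fun k z =>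
    QuantumCF.norm_inner_displacement_le z (w k)
  have hcont : Continuous χ := by
    rw [funext hχ]
    exact continuous_tsum (fun k => QuantumCF.continuous_inner_displacement (w k)) hw.summable hbound
  have hzero : Tendsto χ (cocompact _) (𝓝 0) := by
    rw [funext hχ]
    have h := tendsto_tsum_of_dominated_convergence hw.summable
      (fun k => QuantumCF.tendsto_inner_displacement_cocompact (w k))
      (Eventually.of_forall fun z k => hbound k z)
    simpa using h
  have hlt : ∀ z, z ≠ 0 → ‖χ z‖ < 1 := by
    intro z hz
    have hs : Summable fun k => ‖⟪w k, QuantumCF.displacement z (w k)⟫_ℂ‖ :=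
      Summable.of_nonneg_of_le (fun k => norm_nonneg _) (fun k => hbound k z) hw.summable
    -- Unit trace excludes that all `w k` vanish, and one strict term makes the sum strictly less
    -- than one.
    obtain ⟨k, hk⟩ : ∃ k, w k ≠ 0 := by
      by_contra! h
      simp only [h, norm_zero, ne_eq, OfNat.ofNat_ne_zero, not_false_eq_true, zero_pow] at hw
      exact zero_ne_one (hasSum_zero.unique hw)
    calc ‖χ z‖ ≤ ∑' k, ‖⟪w k, QuantumCF.displacement z (w k)⟫_ℂ‖ := by
          rw [hχ]
          exact norm_tsum_le_tsum_norm hs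
      _ < 1 := hasSum_lt (fun k => hbound k z) (QuantumCF.norm_inner_displacement_lt hz hk)
          hs.hasSum hw
  refine ⟨fun z => hχ z ▸ htr z, ⟨⟨⟨χ, hcont⟩, hzero⟩, rfl⟩, fun ε hε => ?_⟩
  have hne : ∀ z : QuantumCF.PhaseSpace m, ε ≤ ‖z‖ → z ≠ 0 := fun z hz =>
    norm_pos_iff.1 (hε.trans_le hz)
  refine ⟨⟨1, ?_⟩, ?_⟩
  · rintro _ ⟨z, hz, rfl⟩
    exact (hlt z (hne z hz)).le
  rcases Set.eq_empty_or_nonempty {z : QuantumCF.PhaseSpace m | ε ≤ ‖z‖} with h | ⟨z₁, hz₁⟩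
  -- This case occurs for `m = 0`; the real `sSup` of the empty set is `0`.
  · simp [h]
  -- either `‖χ‖` attains its supremum on the closed set, or `χ` vanishes on it
  have hclosed : IsClosed {z : QuantumCF.PhaseSpace m | ε ≤ ‖z‖} :=
    isClosed_le continuous_const continuous_norm
  obtain ⟨z₀, hz₀, hmax⟩ : ∃ z₀ ∈ {z : QuantumCF.PhaseSpace m | ε ≤ ‖z‖},
      ∀ z ∈ {z : QuantumCF.PhaseSpace m | ε ≤ ‖z‖}, ‖χ z‖ ≤ ‖χ z₀‖ := by
    by_cases h : ∃ z ∈ {z : QuantumCF.PhaseSpace m | ε ≤ ‖z‖}, χ z ≠ 0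
    · obtain ⟨z₂, hz₂, h2⟩ := h
      -- Since `χ z₂ ≠ 0`, decay gives `‖χ z‖ ≤ ‖χ z₂‖` off a compact set, so the maximum is sought
      -- on a compact set only.
      refine hcont.norm.continuousOn.exists_isMaxOn' hclosed hz₂ ?_
      have hz := hzero.norm
      rw [norm_zero] at hz
      exact (hz.eventually (ge_mem_nhds (norm_pos_iff.2 h2))).filter_mono inf_le_left
    · push Not at h
      exact ⟨z₁, hz₁, fun z hz => by rw [h z hz, h z₁ hz₁]⟩
  refine (csSup_le (Set.Nonempty.image _ ⟨z₁, hz₁⟩) ?_).trans_lt (hlt z₀ (hne z₀ hz₀))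
  rintro _ ⟨z, hz, rfl⟩
  exact hmax z hz
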